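/- For $n\ge 1$ let $Y_n$ be the set of planar binary trees with $n$ internal vertices: such a tree is either the trivial tree $|$ (a single leaf, no internal vertex) or a root vertex with an ordered pair of planar binary trees, written $(L\,R)$, as its left and right subtrees, and $Y_n$ consists of the trees having exactly $n$ internal vertices. The Tamari order on $Y_n$ is the partial order in which $S\le T$ if and only if $T$ can be obtained from $S$ by a finite (possibly empty) sequence of moves, each of which replaces one subtree of the form $(A\,(B\,C))$ by $((A\,B)\,C)$, where $A,B,C$ are arbitrary planar binary trees, possibly trivial. Let $\mathcal I_n$ be the set of intervals of $Y_n$, that is, of the sets $[S,T]=\{U\in Y_n : S\le U\le T\}$ with $S,T\in Y_n$ and $S\le T$; such an interval is determined by its minimum $S$ and its maximum $T$. Then, for every $n\ge 1$, $$|\mathcal I_n|=\frac{2\,(4n+1)!}{(n+1)!\,(3n+2)!}.$$ -/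

import Mathlib

open scoped Nat

/-- Planar binary trees with `n` internal vertices. A planar binary tree (root at the bottom, leaves
at the top) is either the trivial tree with a single leaf, `BinaryTree.nil`, or the grafting
`BinaryTree.node () l r` of a left subtree `l` and a right subtree `r` on the two leaves of the tree
with one internal vertex; `BinaryTree.numNodes` counts its internal vertices. -/
def PlanarBinaryTree (n : ℕ) : Type :=
  {t : BinaryTree Unit // t.numNodes = n}

/-- The elementary move of the Tamari order: `TamariStep s t` holds when `t` is obtained from `s` by
replacing, at one place of `s`, a local configuration `a (b c)` (two internal vertices joined by a
right edge) by the local configuration `(a b) c` (two internal vertices joined by a left edge). -/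
inductive TamariStep : BinaryTree Unit → BinaryTree Unit → Prop
  | rotate (a b c : BinaryTree Unit) :
      TamariStep (.node () a (.node () b c)) (.node () (.node () a b) c)
  | left {a a' : BinaryTree Unit} (b : BinaryTree Unit) (h : TamariStep a a') :
      TamariStep (.node () a b) (.node () a' b)
  | right (a : BinaryTree Unit) {b b' : BinaryTree Unit} (h : TamariStep b b') :
      TamariStep (.node () a b) (.node () a b')

/-- A tree `t` is larger than `s` if one can go from `s` to `t` by a finite (possibly empty) sequence
of elementary moves. -/
def TamariLE (s t : BinaryTree Unit) : Prop :=
  Relation.ReflTransGen TamariStep s t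

namespace TamariStep

theorem numNodes_eq {s t : BinaryTree Unit} (h : TamariStep s t) : s.numNodes = t.numNodes := by
  induction h with
  | rotate a b c => simp only [BinaryTree.numNodes]; omega
  | left b h ih => simp only [BinaryTree.numNodes]; omega
  | right a h ih => simp only [BinaryTree.numNodes]; omega

/-- The sum, over all internal vertices, of the size of the right subtree; it serves only to show
that the Tamari order is antisymmetric. -/
def rightWeight : BinaryTree Unit → ℕ
  | .nil => 0
  | .node _ a b => rightWeight a + rightWeight b + b.numNodes

theorem rightWeight_lt {s t : BinaryTree Unit} (h : TamariStep s t) :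
    rightWeight t < rightWeight s := by
  induction h with
  | rotate a b c => simp only [rightWeight, BinaryTree.numNodes]; omega
  | left b h ih => simp only [rightWeight]; omega
  | right a h ih => have := h.numNodes_eq; simp only [rightWeight]; omega

end TamariStep

theorem TamariLE.eq_or_rightWeight_lt {s t : BinaryTree Unit} (h : TamariLE s t) :
    s = t ∨ TamariStep.rightWeight t < TamariStep.rightWeight s := by
  induction h with
  | refl => exact Or.inl rfl
  | tail _ h ih =>
    right
    rcases ih with rfl | ih
    · exact h.rightWeight_lt
    · exact h.rightWeight_lt.trans ih

/-- The Tamari order on the set of planar binary trees with `n` internal vertices. (Elementary moves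
preserve the number of internal vertices, so that all intermediate trees have `n` of them too.) -/
instance PlanarBinaryTree.instPartialOrder (n : ℕ) : PartialOrder (PlanarBinaryTree n) where
  le s t := TamariLE s.1 t.1
  le_refl _ := Relation.ReflTransGen.refl
  le_trans _ _ _ hst htu := Relation.ReflTransGen.trans hst htu
  le_antisymm s t hst hts := by
    apply Subtype.ext
    rcases TamariLE.eq_or_rightWeight_lt hst with h | h
    · exact h
    · rcases TamariLE.eq_or_rightWeight_lt hts with h' | h'
      · exact h'.symm
      · omega

/-- The set of intervals of the Tamari lattice on trees with `n` internal vertices: an interval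
`[S, T]` is given by its minimum `S` and its maximum `T`, where `S ≤ T`. -/
abbrev TamariInterval (n : ℕ) : Type :=
  NonemptyInterval (PlanarBinaryTree n)

/-!
The intervals are counted by a functional equation with one catalytic variable, which is then solved
in parametric form.

Grafting on the leftmost leaf cuts a tree along its left spine. Following the elementary moves shows
that the trees above `(S₁ S₂)` are exactly the trees `graft (T₁ U) V` with `S₁ ≤ T₁` and
`S₂ ≤ graft U V` (`tamariRec_iff_tamariLE`), and the size of `T₁` determines `T₁`, `U` and `V`
(`graft_node_inj`). An interval of size `n + 1` is thus a pair of intervals of total size `n`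
together with a place where the left spine of the second maximum is cut. If `t` marks the size and
`x` the length of the left spine of the maximum, the generating series `F` of intervals satisfies
`F = 1 + t x F (x F - F(1)) / (x - 1)` (`catalyticEq_intervalSeries`).

This equation has only one solution in `ℚ[x]⟦t⟧` (`CatalyticEq.unique`), so it suffices to exhibit
one. With `B = 1 + t B ^ 4` and `y = 1 + t x B ^ 2 y ^ 2`, the series `y (B - (B - 1) y)` is a
solution. At `x = 1` the series `y` becomes `B`, whence `F(1) = 2 B ^ 2 - B ^ 3`
(`evalOne_intervalSeries`). The coefficients of the powers of `B` are the Fuss–Catalan numbers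
(`coeff_pow_of_eq_one_add_X_mul_pow_four`), and their combination is the stated quotient.
-/

open BinaryTree

/-! ### A recursive description of the Tamari order -/

/-- Graft the tree `a` on the leftmost leaf of `v`. -/
def graft (a : BinaryTree Unit) : BinaryTree Unit → BinaryTree Unit
  | .nil => a
  | .node _ l r => .node () (graft a l) r

/-- The number of internal vertices on the left spine of a tree. -/
def leftSpine : BinaryTree Unit → ℕ
  | .nil => 0
  | .node _ l _ => leftSpine l + 1

theorem graft_graft (a b c : BinaryTree Unit) : graft (graft a b) c = graft a (graft b c) := by
  induction c with
  | nil => rfl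
  | node _ l r ih _ => simp only [graft, ih]

theorem leftSpine_graft (a b : BinaryTree Unit) :
    leftSpine (graft a b) = leftSpine a + leftSpine b := by
  induction b with
  | nil => rfl
  | node _ l r ih _ => simp only [graft, leftSpine, ih]; omega

theorem numNodes_graft (a b : BinaryTree Unit) :
    (graft a b).numNodes = a.numNodes + b.numNodes := by
  induction b with
  | nil => rfl
  | node _ l r ih _ => simp only [graft, numNodes, ih]; omega

theorem TamariStep.graft_left {a a' : BinaryTree Unit} (h : TamariStep a a')
    (v : BinaryTree Unit) : TamariStep (graft a v) (graft a' v) := by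
  induction v with
  | nil => exact h
  | node _ l r ih _ => exact .left _ ih

theorem TamariStep.graft_right {v v' : BinaryTree Unit} (a : BinaryTree Unit)
    (h : TamariStep v v') : TamariStep (graft a v) (graft a v') := by
  induction h with
  | rotate x b c => exact .rotate _ b c
  | left b _ ih => exact .left b ih
  | right b h _ => exact .right _ h

/-- A move applied to a grafted tree takes place inside one of the two parts. -/
theorem TamariStep.of_graft {a v t : BinaryTree Unit} (h : TamariStep (graft a v) t) :
    (∃ a', TamariStep a a' ∧ t = graft a' v) ∨ ∃ v', TamariStep v v' ∧ t = graft a v' := by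
  induction v generalizing t with
  | nil => exact Or.inl ⟨t, h, rfl⟩
  | node _ l r ih _ =>
    simp only [graft] at h
    cases h with
    | rotate _ b c => exact Or.inr ⟨_, .rotate l b c, rfl⟩
    | left _ h =>
      rcases ih h with ⟨a', h', rfl⟩ | ⟨l', h', rfl⟩
      · exact Or.inl ⟨a', h', rfl⟩
      · exact Or.inr ⟨_, .left r h', rfl⟩
    | right _ h => exact Or.inr ⟨_, .right l h, rfl⟩

theorem TamariLE.node {a a' b b' : BinaryTree Unit} (ha : TamariLE a a') (hb : TamariLE b b') :
    TamariLE (.node () a b) (.node () a' b') :=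
  (Relation.ReflTransGen.lift (fun x => BinaryTree.node () x b)
    (fun _ _ h => TamariStep.left b h) _ _ ha).trans
    (Relation.ReflTransGen.lift (fun x => BinaryTree.node () a' x)
      (fun _ _ h => TamariStep.right a' h) _ _ hb)

/-- Rotations along the left spine of `v` move it out of the right subtree of the root. -/
theorem tamariLE_node_graft (a u v : BinaryTree Unit) :
    TamariLE (.node () a (graft u v)) (graft (.node () a u) v) := by
  induction v with
  | nil => exact .refl
  | node _ l r ih _ =>
    exact (Relation.ReflTransGen.single (TamariStep.rotate a (graft u l) r)).trans
      (ih.node Relation.ReflTransGen.refl)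

/-- The Tamari order described by recursion on the smaller tree: the trees above `(s₁ s₂)` are
obtained from trees `t₁` above `s₁` and `graft u v` above `s₂` by making `u` the right subtree of a
vertex whose left subtree is `t₁`, and grafting the result on the leftmost leaf of `v`. -/
inductive TamariRec : BinaryTree Unit → BinaryTree Unit → Prop
  | nil : TamariRec .nil .nil
  | node {s₁ s₂ t₁ u v : BinaryTree Unit} (h₁ : TamariRec s₁ t₁)
      (h₂ : TamariRec s₂ (graft u v)) :
      TamariRec (.node () s₁ s₂) (graft (.node () t₁ u) v)

theorem TamariRec.refl (s : BinaryTree Unit) : TamariRec s s := by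
  induction s with
  | nil => exact .nil
  | node _ l r hl hr => exact TamariRec.node (v := .nil) hl hr

theorem TamariRec.tail {s t t' : BinaryTree Unit} (h : TamariRec s t) (ht : TamariStep t t') :
    TamariRec s t' := by
  induction h generalizing t' with
  | nil => cases ht
  | @node s₁ s₂ t₁ u v h₁ h₂ ih₁ ih₂ =>
    rcases ht.of_graft with ⟨a', ha, rfl⟩ | ⟨v', hv, rfl⟩
    · cases ha with
      | rotate _ b c =>
        -- The right child of the rotated vertex joins the left spine: `b` takes the place of `u`,
        -- and `c` becomes the right subtree of the last left spine vertex of the new `v`.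
        have key := TamariRec.node (u := b) (v := graft (.node () .nil c) v) h₁
          (by rw [← graft_graft]; exact h₂)
        rwa [← graft_graft] at key
      | left _ h => exact .node (ih₁ h) h₂
      | right _ h => exact .node h₁ (ih₂ (h.graft_left v))
    · exact .node h₁ (ih₂ (hv.graft_right u))

theorem tamariRec_iff_tamariLE {s t : BinaryTree Unit} : TamariRec s t ↔ TamariLE s t := by
  constructor
  · intro h
    induction h with
    | nil => exact .refl
    | node _ _ ih₁ ih₂ => exact (ih₁.node ih₂).trans (tamariLE_node_graft _ _ _)
  · intro h
    induction h with
    | refl => exact .refl s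
    | tail _ h ih => exact ih.tail h

theorem TamariLE.numNodes_eq {s t : BinaryTree Unit} (h : TamariLE s t) :
    s.numNodes = t.numNodes := by
  induction h with
  | refl => rfl
  | tail _ h ih => exact ih.trans h.numNodes_eq

/-- The decomposition in `TamariRec.node` is determined by the size of `t₁`. -/
theorem graft_node_inj {t₁ t₁' u u' v v' : BinaryTree Unit} (hn : t₁.numNodes = t₁'.numNodes)
    (h : graft (.node () t₁ u) v = graft (.node () t₁' u') v') :
    t₁ = t₁' ∧ u = u' ∧ v = v' := by
  induction v generalizing v' with
  | nil =>
    cases v' with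
    | nil => simpa [graft] using h
    | node _ l r =>
      simp only [graft, node.injEq] at h
      have := congrArg numNodes h.2.1
      simp only [numNodes_graft, numNodes] at this
      omega
  | node _ l r ih _ =>
    cases v' with
    | nil =>
      simp only [graft, node.injEq] at h
      have := congrArg numNodes h.2.1
      simp only [numNodes_graft, numNodes] at this
      omega
    | node _ l' r' =>
      simp only [graft, node.injEq, true_and] at h
      obtain ⟨h₁, h₂, h₃⟩ := ih h.1
      exact ⟨h₁, h₂, by rw [h₃, h.2]⟩

/-- The subtree of a tree reached from the root by `k` steps along the left spine; it is trivial if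
the left spine has fewer than `k` vertices. -/
def cutTop : BinaryTree Unit → ℕ → BinaryTree Unit
  | t, 0 => t
  | .nil, _ + 1 => .nil
  | .node _ l _, k + 1 => cutTop l k

/-- The part of a tree spanned by the first `k` vertices of its left spine, counted from the root,
and their right subtrees. -/
def cutBottom : BinaryTree Unit → ℕ → BinaryTree Unit
  | _, 0 => .nil
  | .nil, _ + 1 => .nil
  | .node _ l r, k + 1 => .node () (cutBottom l k) r

theorem graft_cutTop_cutBottom (t : BinaryTree Unit) (k : ℕ) :
    graft (cutTop t k) (cutBottom t k) = t := by
  induction t generalizing k with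
  | nil => cases k <;> rfl
  | node _ l r ih _ => cases k <;> simp [cutTop, cutBottom, graft, ih]

theorem leftSpine_cutBottom {t : BinaryTree Unit} {k : ℕ} (hk : k ≤ leftSpine t) :
    leftSpine (cutBottom t k) = k := by
  induction t generalizing k with
  | nil => cases k <;> simp_all [leftSpine, cutBottom]
  | node _ l r ih _ => cases k <;> simp_all [leftSpine, cutBottom]

theorem cut_graft (u v : BinaryTree Unit) :
    cutTop (graft u v) (leftSpine v) = u ∧ cutBottom (graft u v) (leftSpine v) = v := by
  induction v with
  | nil => simp [leftSpine, cutTop, cutBottom, graft]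
  | node _ l r ih _ => simp [leftSpine, cutTop, cutBottom, graft, ih]

/-! ### The refined enumeration of intervals -/

open Polynomial Finset

open Classical in
/-- The pairs `(S, T)` of trees with `n` internal vertices such that `S ≤ T`. -/
noncomputable def tamariPairs (n : ℕ) : Finset (BinaryTree Unit × BinaryTree Unit) :=
  (treesOfNumNodesEq n ×ˢ treesOfNumNodesEq n).filter fun p => TamariLE p.1 p.2

theorem mem_tamariPairs {n : ℕ} {p : BinaryTree Unit × BinaryTree Unit} :
    p ∈ tamariPairs n ↔ p.1.numNodes = n ∧ TamariLE p.1 p.2 := by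
  simp only [tamariPairs, mem_filter, mem_product, mem_treesOfNumNodesEq]
  exact ⟨fun h => ⟨h.1.1, h.2⟩, fun h => ⟨⟨h.1, h.2.numNodes_eq ▸ h.1⟩, h.2⟩⟩

theorem card_tamariInterval (n : ℕ) : Nat.card (TamariInterval n) = #(tamariPairs n) := by
  rw [← Nat.card_eq_finsetCard]
  exact Nat.card_congr
    { toFun := fun I => ⟨(I.fst.1, I.snd.1), mem_tamariPairs.2 ⟨I.fst.2, I.fst_le_snd⟩⟩
      invFun := fun p =>
        have h := mem_tamariPairs.1 p.2
        ⟨(⟨p.1.1, h.1⟩, ⟨p.1.2, h.2.numNodes_eq ▸ h.1⟩), h.2⟩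
      left_inv := fun _ => rfl
      right_inv := fun _ => rfl }

/-- The polynomial in which an interval `[S, T]` of trees with `n` internal vertices contributes
`x ^ k`, where `k` is the length of the left spine of `T`. -/
noncomputable def intervalPoly (n : ℕ) : ℚ[X] :=
  ∑ p ∈ tamariPairs n, X ^ leftSpine p.2

/-- The polynomial in which an interval `[S, T]` of trees with `n` internal vertices contributes
`1 + x + ⋯ + x ^ k`, where `k` is the length of the left spine of `T`. -/
noncomputable def cutIntervalPoly (n : ℕ) : ℚ[X] :=
  ∑ p ∈ tamariPairs n, ∑ k ∈ range (leftSpine p.2 + 1), X ^ k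

theorem eval_one_intervalPoly (n : ℕ) : (intervalPoly n).eval 1 = #(tamariPairs n) := by
  simp [intervalPoly, eval_finsetSum]

theorem intervalPoly_zero : intervalPoly 0 = 1 := by
  have : tamariPairs 0 = {(.nil, .nil)} := by
    ext ⟨s, t⟩
    simp only [mem_tamariPairs, mem_singleton, Prod.mk.injEq]
    constructor
    · rintro ⟨h, h'⟩
      have h2 := h'.numNodes_eq
      cases s <;> cases t <;> simp_all [numNodes]
    · rintro ⟨rfl, rfl⟩
      exact ⟨rfl, .refl⟩
  simp [intervalPoly, this, leftSpine]

/-- Summing the geometric series `1 + x + ⋯ + x ^ k` expresses the count of cut intervals by the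
count of intervals; this is where the value at `x = 1` enters the functional equation. -/
theorem X_sub_one_mul_cutIntervalPoly (n : ℕ) :
    (X - 1) * cutIntervalPoly n = X * intervalPoly n - C ((intervalPoly n).eval 1) := by
  rw [eval_one_intervalPoly, cutIntervalPoly, intervalPoly, mul_sum, mul_sum]
  simp_rw [mul_geom_sum, pow_succ']
  simp [sum_sub_distrib]

/-- Cutting the larger tree as in `TamariRec.node` decomposes an interval into two intervals, the
second of which comes with a place `k` where the left spine of its larger tree is cut. -/
theorem intervalPoly_succ (n : ℕ) :
    intervalPoly (n + 1) =
      X * ∑ a ∈ antidiagonal n, intervalPoly a.1 * cutIntervalPoly a.2 := by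
  have hsum : X * ∑ a ∈ antidiagonal n, intervalPoly a.1 * cutIntervalPoly a.2 =
      ∑ a ∈ antidiagonal n, ∑ p ∈ tamariPairs a.1, ∑ q ∈ tamariPairs a.2,
        ∑ k ∈ range (leftSpine q.2 + 1), (X : ℚ[X]) ^ (leftSpine p.2 + 1 + k) := by
    rw [mul_sum]
    refine sum_congr rfl fun a _ => ?_
    rw [intervalPoly, cutIntervalPoly, sum_mul_sum, mul_sum]
    refine sum_congr rfl fun p _ => ?_
    rw [mul_sum]
    refine sum_congr rfl fun q _ => ?_
    rw [mul_sum, mul_sum]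
    refine sum_congr rfl fun k _ => ?_
    ring
  rw [hsum]
  simp_rw [sum_sigma']
  symm
  rw [intervalPoly]
  refine sum_bij (fun z _ => (.node () z.2.1.1 z.2.2.1.1,
    graft (.node () z.2.1.2 (cutTop z.2.2.1.2 z.2.2.2)) (cutBottom z.2.2.1.2 z.2.2.2)))
    ?_ ?_ ?_ ?_
  · rintro ⟨⟨i, j⟩, ⟨s₁, t₁⟩, ⟨s₂, t₂⟩, k⟩ hz
    simp only [mem_sigma, HasAntidiagonal.mem_antidiagonal, mem_tamariPairs, mem_range] at hz ⊢
    obtain ⟨hij, ⟨rfl, h₁⟩, ⟨rfl, h₂⟩, hk⟩ := hz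
    refine ⟨by simp only [numNodes]; omega, ?_⟩
    rw [← tamariRec_iff_tamariLE] at h₁ h₂ ⊢
    exact .node h₁ (by rwa [graft_cutTop_cutBottom])
  · rintro ⟨⟨i, j⟩, ⟨s₁, t₁⟩, ⟨s₂, t₂⟩, k⟩ hz ⟨⟨i', j'⟩, ⟨s₁', t₁'⟩, ⟨s₂', t₂'⟩, k'⟩ hz' h
    simp only [mem_sigma, HasAntidiagonal.mem_antidiagonal, mem_tamariPairs, mem_range] at hz hz'
    obtain ⟨hij, ⟨rfl, h₁⟩, ⟨rfl, h₂⟩, hk⟩ := hz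
    obtain ⟨hij', ⟨rfl, h₁'⟩, ⟨rfl, h₂'⟩, hk'⟩ := hz'
    simp only [Prod.mk.injEq, node.injEq, true_and] at h
    obtain ⟨⟨rfl, rfl⟩, h⟩ := h
    obtain ⟨rfl, hu, hv⟩ := graft_node_inj (h₁.numNodes_eq.symm.trans h₁'.numNodes_eq) h
    have ht : t₂ = t₂' := by
      rw [← graft_cutTop_cutBottom t₂ k, ← graft_cutTop_cutBottom t₂' k', hu, hv]
    have hkk : k = k' := by
      rw [← leftSpine_cutBottom (Nat.lt_succ_iff.1 hk),
        ← leftSpine_cutBottom (Nat.lt_succ_iff.1 hk'), hv]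
    subst ht hkk
    rfl
  · rintro ⟨s, t⟩ hst
    rw [mem_tamariPairs] at hst
    obtain ⟨hn, hst⟩ := hst
    cases tamariRec_iff_tamariLE.2 hst with
    | nil => simp [numNodes] at hn
    | @node s₁ s₂ t₁ u v h₁ h₂ =>
      refine ⟨⟨(s₁.numNodes, s₂.numNodes), (s₁, t₁), (s₂, graft u v), leftSpine v⟩, ?_, ?_⟩
      · simp only [mem_sigma, HasAntidiagonal.mem_antidiagonal, mem_tamariPairs, mem_range,
          leftSpine_graft]
        simp only [numNodes] at hn
        exact ⟨by omega, ⟨trivial, tamariRec_iff_tamariLE.1 h₁⟩,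
          ⟨trivial, tamariRec_iff_tamariLE.1 h₂⟩, by omega⟩
      · simp only [cut_graft]
  · rintro ⟨⟨i, j⟩, ⟨s₁, t₁⟩, ⟨s₂, t₂⟩, k⟩ hz
    simp only [mem_sigma, mem_range] at hz
    dsimp only at hz ⊢
    rw [leftSpine_graft, leftSpine_cutBottom (by omega), leftSpine]

/-! ### Power series -/

namespace PowerSeries

open Finset

/-- A self-map `Φ` of the ring of power series that is contracting for the `X`-adic topology has a
fixed point. -/
theorem exists_fixedPoint {R : Type*} [CommRing R] (Φ : R⟦X⟧ → R⟦X⟧)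
    (hΦ : ∀ n f g, X ^ n ∣ f - g → X ^ (n + 1) ∣ Φ f - Φ g) : ∃ f, Φ f = f := by
  have hstep : ∀ n, X ^ n ∣ Φ^[n + 1] 0 - Φ^[n] 0 := by
    intro n
    induction n with
    | zero => simp
    | succ n ih =>
      have := hΦ _ _ _ ih
      rwa [← Function.iterate_succ_apply' Φ, ← Function.iterate_succ_apply' Φ] at this
  have hle : ∀ n m, n ≤ m → X ^ n ∣ Φ^[m] 0 - Φ^[n] 0 := by
    intro n m hnm
    induction m, hnm using Nat.le_induction with
    | base => simp
    | succ m hnm ih =>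
      have := dvd_add ((pow_dvd_pow X hnm).trans (hstep m)) ih
      rwa [sub_add_sub_cancel] at this
  -- The limit of the iterates: its `n`-th coefficient is that of the `n + 1`-st iterate.
  let f : R⟦X⟧ := mk fun n => coeff n (Φ^[n + 1] 0)
  have hf : ∀ n, X ^ n ∣ f - Φ^[n] 0 := by
    intro n
    rw [X_pow_dvd_iff]
    intro m hm
    have := X_pow_dvd_iff.1 (hle (m + 1) n hm) m (Nat.lt_succ_self m)
    rw [map_sub, sub_eq_zero] at this
    rw [map_sub, coeff_mk, this, sub_self]
  refine ⟨f, ?_⟩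
  ext n
  have h₁ := hΦ n _ _ (hf n)
  rw [← Function.iterate_succ_apply' Φ] at h₁
  have h₂ := dvd_sub h₁ (hf (n + 1))
  rw [sub_sub_sub_cancel_right] at h₂
  have := X_pow_dvd_iff.1 h₂ n (Nat.lt_succ_self n)
  rwa [map_sub, sub_eq_zero] at this

theorem exists_eq_one_add_X_mul_pow {R : Type*} [CommRing R] (a : R⟦X⟧) (m : ℕ) :
    ∃ f : R⟦X⟧, f = 1 + X * a * f ^ m := by
  obtain ⟨f, hf⟩ := exists_fixedPoint (fun f : R⟦X⟧ => 1 + X * a * f ^ m) (by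
    intro n f g h
    have : (1 + X * a * f ^ m) - (1 + X * a * g ^ m) = X * (a * (f ^ m - g ^ m)) := by ring
    rw [this, pow_succ']
    exact mul_dvd_mul_left _ (dvd_mul_of_dvd_right (h.trans (sub_dvd_pow_sub_pow f g m)) a))
  exact ⟨f, hf.symm⟩

/-- The Fuss–Catalan coefficients of the powers of the solution of `B = 1 + t B ^ 4`. They follow
by induction from `B ^ (r + 1) = B ^ r + t B ^ (r + 4)`, without Lagrange inversion. -/
theorem coeff_pow_of_eq_one_add_X_mul_pow_four {B : ℚ⟦X⟧} (hB : B = 1 + X * B ^ 4) (n r : ℕ) :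
    coeff n (B ^ (r + 1)) = (r + 1) * (4 * n + r)! / (n ! * (3 * n + r + 1)!) := by
  induction n generalizing r with
  | zero =>
    have h0 : constantCoeff B = 1 := by rw [hB]; simp
    have : ((r ! : ℕ) : ℚ) ≠ 0 := by positivity
    simp [h0, Nat.factorial_succ]
    field_simp
  | succ n ihn =>
    have hrec : ∀ r, coeff (n + 1) (B ^ (r + 1)) =
        coeff (n + 1) (B ^ r) + coeff n (B ^ (r + 3 + 1)) := by
      intro r
      have : B ^ (r + 1) = B ^ r + X * B ^ (r + 3 + 1) := by
        linear_combination B ^ r * hB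
      rw [this, map_add, coeff_succ_X_mul]
    induction r with
    | zero =>
      rw [hrec, ihn, pow_zero, coeff_one, if_neg (Nat.succ_ne_zero n)]
      rw [show 4 * (n + 1) + 0 = 4 * n + 3 + 1 by ring, show 3 * (n + 1) + 0 + 1 = 3 * n + 4 by ring,
        show 4 * n + (0 + 3) = 4 * n + 3 by ring, show 3 * n + (0 + 3) + 1 = 3 * n + 4 by ring,
        Nat.factorial_succ (4 * n + 3), Nat.factorial_succ n]
      push_cast
      field_simp
      ring
    | succ r ih =>
      rw [hrec, ihn, ih]
      rw [show 4 * (n + 1) + (r + 1) = 4 * n + r + 4 + 1 by ring,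
        show 4 * (n + 1) + r = 4 * n + r + 4 by ring,
        show 4 * n + (r + 1 + 3) = 4 * n + r + 4 by ring,
        show 3 * (n + 1) + (r + 1) + 1 = 3 * n + r + 4 + 1 by ring,
        show 3 * (n + 1) + r + 1 = 3 * n + r + 4 by ring,
        show 3 * n + (r + 1 + 3) + 1 = 3 * n + r + 4 + 1 by ring,
        Nat.factorial_succ (4 * n + r + 4), Nat.factorial_succ n,
        Nat.factorial_succ (3 * n + r + 4)]
      push_cast
      field_simp
      ring

end PowerSeries

/-! ### The functional equation -/

/-- Evaluation at `x = 1` of a power series in `t` whose coefficients are polynomials in `x`. -/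
noncomputable def evalOne : PowerSeries ℚ[X] →+* PowerSeries ℚ :=
  PowerSeries.map (Polynomial.evalRingHom 1)

/-- Power series in `t` regarded as power series with coefficients constant in `x`. -/
noncomputable def constX : PowerSeries ℚ →+* PowerSeries ℚ[X] :=
  PowerSeries.map Polynomial.C

theorem evalOne_constX (f : PowerSeries ℚ) : evalOne (constX f) = f := by
  ext n
  simp [evalOne, constX]

/-- The functional equation `F = 1 + t x F (x F - F(1)) / (x - 1)` of the interval series, with the
denominator `x - 1` cleared. -/
def CatalyticEq (F : PowerSeries ℚ[X]) : Prop :=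
  PowerSeries.C (X - 1 : ℚ[X]) * (F - 1) =
    PowerSeries.X * PowerSeries.C X * F * (PowerSeries.C X * F - constX (evalOne F))

/-- The functional equation determines a power series, since it gives each coefficient in terms of
the previous ones. -/
theorem CatalyticEq.unique {F G : PowerSeries ℚ[X]} (hF : CatalyticEq F) (hG : CatalyticEq G) :
    F = G := by
  have hdvd : ∀ n, PowerSeries.X ^ n ∣ F - G := by
    intro n
    induction n with
    | zero => simp
    | succ n ih =>
      have he : PowerSeries.X ^ n ∣ constX (evalOne (F - G)) := by
        have := map_dvd (constX.comp evalOne) ih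
        simpa [evalOne, constX] using this
      have hmul : PowerSeries.C (X - 1 : ℚ[X]) * (F - G) = PowerSeries.X * (PowerSeries.C X *
          ((F - G) * (PowerSeries.C X * F - constX (evalOne F)) +
            G * (PowerSeries.C X * (F - G) - constX (evalOne (F - G))))) := by
        unfold CatalyticEq at hF hG
        rw [map_sub evalOne, map_sub constX]
        linear_combination hF - hG
      have h : PowerSeries.X ^ (n + 1) ∣ PowerSeries.C (X - 1 : ℚ[X]) * (F - G) := by
        rw [hmul, pow_succ']
        exact mul_dvd_mul_left _ (dvd_mul_of_dvd_right (dvd_add (dvd_mul_of_dvd_left ih _)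
          (dvd_mul_of_dvd_right (dvd_sub (dvd_mul_of_dvd_right ih _) he) _)) _)
      rw [PowerSeries.X_pow_dvd_iff] at h ⊢
      intro m hm
      have := h m hm
      rw [PowerSeries.coeff_C_mul] at this
      exact (mul_eq_zero.1 this).resolve_left (Polynomial.X_sub_C_ne_zero 1)
  ext1 n
  have := PowerSeries.X_pow_dvd_iff.1 (hdvd (n + 1)) n (Nat.lt_succ_self n)
  rwa [map_sub, sub_eq_zero] at this

/-- The generating series of intervals, in `t` for the size and `x` for the length of the left spine
of the maximum. -/
noncomputable def intervalSeries : PowerSeries ℚ[X] :=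
  PowerSeries.mk intervalPoly

theorem catalyticEq_intervalSeries : CatalyticEq intervalSeries := by
  have h₁ : intervalSeries - 1 =
      PowerSeries.X * (PowerSeries.C X * (intervalSeries * PowerSeries.mk cutIntervalPoly)) := by
    ext1 n
    cases n with
    | zero => simp [intervalSeries, intervalPoly_zero]
    | succ n =>
      rw [PowerSeries.coeff_succ_X_mul, PowerSeries.coeff_C_mul, PowerSeries.coeff_mul]
      simp [intervalSeries, intervalPoly_succ, PowerSeries.coeff_one]
  have h₂ : PowerSeries.C (X - 1 : ℚ[X]) * PowerSeries.mk cutIntervalPoly =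
      PowerSeries.C X * intervalSeries - constX (evalOne intervalSeries) := by
    ext1 n
    rw [map_sub (PowerSeries.coeff n), PowerSeries.coeff_C_mul, PowerSeries.coeff_C_mul, PowerSeries.coeff_mk,
      X_sub_one_mul_cutIntervalPoly]
    simp [constX, evalOne, intervalSeries]
  unfold CatalyticEq
  rw [h₁, ← h₂]
  ring

/-! ### Solution of the functional equation -/

/-- The parametrization of the solution: if `B = 1 + t B ^ 4` and `y = 1 + t x B ^ 2 y ^ 2`, then
`y (B - (B - 1) y)` solves the functional equation, and `y` becomes `B` for `x = 1`. -/
theorem evalOne_intervalSeries {B : PowerSeries ℚ} (hB : B = 1 + PowerSeries.X * B ^ 4) :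
    evalOne intervalSeries = 2 * B ^ 2 - B ^ 3 := by
  obtain ⟨y, hy⟩ := PowerSeries.exists_eq_one_add_X_mul_pow
    (PowerSeries.C (X : ℚ[X]) * constX B ^ 2) 2
  have hy0 : PowerSeries.constantCoeff y = 1 := by rw [hy]; simp
  have hev : evalOne y = B := by
    have h := congrArg evalOne hy
    simp only [map_add, map_mul, map_pow, map_one, evalOne_constX] at h
    have hX : evalOne PowerSeries.X = PowerSeries.X := by simp [evalOne]
    have hC : evalOne (PowerSeries.C X) = 1 := by simp [evalOne]
    rw [hX, hC] at h
    have hmul : (evalOne y - B) * (1 - PowerSeries.X * (B ^ 2 * (evalOne y + B))) = 0 := by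
      linear_combination h - hB
    -- The second factor has constant coefficient `1`.
    refine sub_eq_zero.1 ((mul_eq_zero.1 hmul).resolve_right fun h0 => ?_)
    simpa using congrArg PowerSeries.constantCoeff h0
  set b := constX B with hb
  have hb4 : b = 1 + PowerSeries.X * b ^ 4 := by
    have := congrArg constX hB
    rwa [map_add, map_mul, map_pow, map_one,
      show constX PowerSeries.X = PowerSeries.X by simp [constX]] at this
  have hb0 : PowerSeries.constantCoeff b = 1 := by rw [hb4]; simp
  set F := y * (b - (b - 1) * y) with hF
  have hFev : evalOne F = 2 * B ^ 2 - B ^ 3 := by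
    rw [hF, map_mul, map_sub, map_mul, map_sub, map_one, hev, hb, evalOne_constX]
    ring
  suffices h : CatalyticEq F by rw [catalyticEq_intervalSeries.unique h, hFev]
  unfold CatalyticEq
  rw [hFev, map_sub constX, map_mul, map_pow, map_pow, ← hb, map_ofNat, map_sub, map_one]
  set t : PowerSeries ℚ[X] := PowerSeries.X
  set x : PowerSeries ℚ[X] := PowerSeries.C X
  -- The two equations factor `F - 1`, `x F - F(1)` and `x - 1`, up to powers of `t`, `b` and `y`;
  -- the two sides of the functional equation then have the same factors.
  have h₁ : F - 1 = t * x * b ^ 2 * y ^ 2 * (1 - (b - 1) * y) := by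
    rw [hF]
    linear_combination (1 - (b - 1) * y) * hy
  have h₂ : t * b ^ 2 * y * (x * F - (2 * b ^ 2 - b ^ 3)) = (1 - (b - 1) * y) * (y - b) := by
    rw [hF]
    linear_combination (-(b - (b - 1) * y)) * hy + y * (2 - b) * hb4
  have h₃ : t * (x - 1) * b ^ 4 * y ^ 2 = (b - (b - 1) * y) * (y - b) := by
    linear_combination (-b ^ 2) * hy + y ^ 2 * hb4
  have hne : t * b ^ 4 * y ≠ 0 := by
    have hb' : b ≠ 0 := fun h => by simp [h] at hb0
    have hy' : y ≠ 0 := fun h => by simp [h] at hy0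
    exact mul_ne_zero (mul_ne_zero PowerSeries.X_ne_zero (pow_ne_zero 4 hb')) hy'
  refine mul_left_cancel₀ hne ?_
  calc t * b ^ 4 * y * ((x - 1) * (F - 1))
      = t * x * b ^ 2 * y * (1 - (b - 1) * y) * (t * (x - 1) * b ^ 4 * y ^ 2) := by
        rw [h₁]; ring
    _ = t * x * b ^ 2 * F * ((1 - (b - 1) * y) * (y - b)) := by rw [h₃, hF]; ring
    _ = t * b ^ 4 * y * (t * x * F * (x * F - (2 * b ^ 2 - b ^ 3))) := by rw [← h₂]; ring

theorem mainTheorem1 (n : ℕ) (hn : 1 ≤ n) :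
    (Nat.card (TamariInterval n) : ℚ) =
      (2 * (4 * n + 1)! : ℚ) / ((n + 1)! * (3 * n + 2)! : ℚ) := by
  obtain ⟨B, hB⟩ := PowerSeries.exists_eq_one_add_X_mul_pow (1 : PowerSeries ℚ) 4
  rw [mul_one] at hB
  have h := congrArg (PowerSeries.coeff n) (evalOne_intervalSeries hB)
  have h2 := PowerSeries.coeff_pow_of_eq_one_add_X_mul_pow_four hB n 1
  have h3 := PowerSeries.coeff_pow_of_eq_one_add_X_mul_pow_four hB n 2
  have hcoeff : PowerSeries.coeff n (evalOne intervalSeries) = #(tamariPairs n) := by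
    simp [evalOne, intervalSeries, eval_one_intervalPoly]
  rw [card_tamariInterval, ← hcoeff, h, two_mul, map_sub, map_add, h2, h3,
    Nat.factorial_succ (3 * n + 2),
    show 4 * n + 2 = 4 * n + 1 + 1 from rfl, Nat.factorial_succ (4 * n + 1),
    Nat.factorial_succ n]
  push_cast
  field_simp
  ring
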